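/- Let $X$ be a separable real normed space and let $k\in\mathbb N\cup\{\infty\}$. Assume that $X$ admits a bump function of class $C^k$ that is Lipschitz, i.e. a non-zero function $b:X\to\mathbb R$ that is $C^k$ (in the Fréchet sense), Lipschitz, and vanishes outside some ball. Let $\omega:(0,\infty)\to\mathbb R$ be a non-decreasing function satisfying $$\lim_{t\to0}\omega(t)=0,\qquad \lim_{t\to\infty}\omega(t)=\infty,\qquad \lim_{t\to0}\frac{t}{\omega(t)}=0,\qquad \omega(2t)\le C_{\mathrm{db}}\,\omega(t)\quad(t>0)$$ for some constant $C_{\mathrm{db}}>1$ (then $\omega>0$). For $f:X\to\mathbb R$ put $$\|f\|_{\dot C^{0,\omega}}=\sup_{x\ne y}\frac{|f(x)-f(y)|}{\omega(\|x-y\|)},\qquad \operatorname{osc}_\delta^\omega(f)=\sup_{x\neq y,\ \|x-y\|=\delta}\frac{|f(x)-f(y)|}{\omega(\|x-y\|)},$$ and let $\dot C^{0,\omega}(X)$ be the set of $f:X\to\mathbb R$ with $\|f\|_{\dot C^{0,\omega}}<\infty$. Let $\dot{\mathrm{VC}}^{0,\omega}_{\mathrm{small}}(X)$ be the set of those $f\in\dot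 C^{0,\omega}(X)$ with $\lim_{\delta\to0}\operatorname{osc}^\omega_\delta(f)=0$, and let $\dot{\mathrm{VC}}^{0,\omega}(X)$ be the set of those $f\in\dot{\mathrm{VC}}^{0,\omega}_{\mathrm{small}}(X)$ for which moreover $$\lim_{\delta\to\infty}\operatorname{osc}^\omega_\delta(f)=0\qquad\text{and}\qquad \lim_{\delta\to\infty}\ \sup_{x\ne y,\ \min(\|x\|,\|y\|)>\delta}\frac{|f(x)-f(y)|}{\omega(\|x-y\|)}=0 .$$ For a set $\mathcal C$ of functions $X\to\mathbb R$, let $\overline{\mathcal C}^{\dot C^{0,\omega}(X)}$ be the set of all $f\in\dot C^{0,\omega}(X)$ for which there is a sequence $(f_n)_n\subset\mathcal C$ with $\|f_n-f\|_{\dot C^{0,\omega}}\to0$. Let $C^k(X)$ and $\mathrm{Lip}(X)$ be the sets of real-valued $C^k$ and Lipschitz functions on $X$, and $C^k_{\mathrm{bs}}(X)$ the set of functions in $C^k(X)$ with bounded support. Then 1. $\overline{C^k(X)\cap\mathrm{Lip}(X)\cap\dot C^{0,\omega}(X)}^{\dot C^{0,\omega}(X)}=\dot{\mathrm{VC}}^{0,\omega}_{\mathrm{small}}(X)$;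 2. $\overline{C^k_{\mathrm{bs}}(X)\cap\mathrm{Lip}(X)}^{\dot C^{0,\omega}(X)}=\dot{\mathrm{VC}}^{0,\omega}(X)$. -/

import Mathlib

open Filter Topology
open scoped ENNReal NNReal

namespace VanishingHolder

variable {X Y : Type*} [NormedAddCommGroup X] [NormedAddCommGroup Y]

/-- The standing assumptions on a modulus of continuity. Only the values of `ω` on `(0, ∞)`
matter. (Positivity of `ω` on `(0, ∞)` follows, see `IsModulus.pos`.) -/
structure IsModulus (ω : ℝ → ℝ) : Prop where
  monotoneOn : MonotoneOn ω (Set.Ioi 0)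
  tendsto_zero : Tendsto ω (𝓝[>] 0) (𝓝 0)
  tendsto_atTop : Tendsto ω atTop atTop
  tendsto_div : Tendsto (fun t => t / ω t) (𝓝[>] 0) (𝓝 0)
  doubling : ∃ C : ℝ, 1 < C ∧ ∀ t : ℝ, 0 < t → ω (2 * t) ≤ C * ω t

theorem IsModulus.pos {ω : ℝ → ℝ} (h : IsModulus ω) {t : ℝ} (ht : 0 < t) : 0 < ω t := by
  obtain ⟨C, hC, hdb⟩ := h.doubling
  by_contra hneg
  have key : ∀ n : ℕ, ω (2 ^ n * t) ≤ 0 := by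
    intro n
    induction n with
    | zero => simpa using hneg
    | succ n ih =>
      have h1 := hdb (2 ^ n * t) (by positivity)
      rw [show (2 : ℝ) ^ (n + 1) * t = 2 * (2 ^ n * t) by ring]
      nlinarith
  have hlim : Tendsto (fun n : ℕ => (2 : ℝ) ^ n * t) atTop atTop :=
    (tendsto_pow_atTop_atTop_of_one_lt (by norm_num)).atTop_mul_const ht
  obtain ⟨n, hn⟩ := ((h.tendsto_atTop.comp hlim).eventually_gt_atTop 0).exists
  exact absurd (key n) (not_le.mpr hn)

/-- The oscillation quotient `‖f x - f y‖ / ω ‖x - y‖`, as an extended nonnegative real. -/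
noncomputable def oscPair (ω : ℝ → ℝ) (f : X → Y) (x y : X) : ℝ≥0∞ :=
  ‖f x - f y‖ₑ / ENNReal.ofReal (ω ‖x - y‖)

/-- The supremum of the oscillation quotients over distinct points at distance exactly `δ`. -/
noncomputable def oscAt (ω : ℝ → ℝ) (f : X → Y) (δ : ℝ) : ℝ≥0∞ :=
  ⨆ (x : X) (y : X) (_ : x ≠ y) (_ : ‖x - y‖ = δ), oscPair ω f x y

/-- The supremum of the oscillation quotients over distinct points of norm larger than `δ`. -/
noncomputable def oscFar (ω : ℝ → ℝ) (f : X → Y) (δ : ℝ) : ℝ≥0∞ :=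
  ⨆ (x : X) (y : X) (_ : x ≠ y) (_ : δ < min ‖x‖ ‖y‖), oscPair ω f x y

/-- The homogeneous Hölder seminorm (possibly infinite). -/
noncomputable def holderSeminorm (ω : ℝ → ℝ) (f : X → Y) : ℝ≥0∞ :=
  ⨆ (x : X) (y : X) (_ : x ≠ y), oscPair ω f x y

variable (X Y) in
/-- The homogeneous Hölder space. -/
def HolderSpace (ω : ℝ → ℝ) : Set (X → Y) :=
  {f | holderSeminorm ω f < ∞}

variable (X Y) in
/-- Functions with vanishing oscillation at small scales. -/
def VSmall (ω : ℝ → ℝ) : Set (X → Y) :=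
  {f | Tendsto (oscAt ω f) (𝓝[>] 0) (𝓝 0)}

variable (X Y) in
/-- Functions with vanishing oscillation at large scales. -/
def VLarge (ω : ℝ → ℝ) : Set (X → Y) :=
  {f | Tendsto (oscAt ω f) atTop (𝓝 0)}

variable (X Y) in
/-- Functions with vanishing oscillation far away from the origin. -/
def VFar (ω : ℝ → ℝ) : Set (X → Y) :=
  {f | Tendsto (oscFar ω f) atTop (𝓝 0)}

variable (X Y) in
/-- The small-scale vanishing subspace of the Hölder space. -/
def VCSmall (ω : ℝ → ℝ) : Set (X → Y) := VSmall X Y ω ∩ HolderSpace X Y ω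

variable (X Y) in
/-- The large-scale vanishing subspace of the Hölder space. -/
def VCLarge (ω : ℝ → ℝ) : Set (X → Y) := VLarge X Y ω ∩ HolderSpace X Y ω

variable (X Y) in
/-- The far-away vanishing subspace of the Hölder space. -/
def VCFar (ω : ℝ → ℝ) : Set (X → Y) := VFar X Y ω ∩ HolderSpace X Y ω

variable (X Y) in
/-- The subspace of the Hölder space with vanishing at all three scales. -/
def VC (ω : ℝ → ℝ) : Set (X → Y) := VCSmall X Y ω ∩ VCFar X Y ω ∩ VCLarge X Y ω

/-- The closure of a family `S` in the Hölder space under the Hölder seminorm: the functions in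
the Hölder space which are limits, in the seminorm, of sequences in `S`. -/
def holderClosure (ω : ℝ → ℝ) (S : Set (X → Y)) : Set (X → Y) :=
  {f | f ∈ HolderSpace X Y ω ∧ ∃ F : ℕ → X → Y, (∀ n, F n ∈ S) ∧
    Tendsto (fun n => holderSeminorm ω (fun x => F n x - f x)) atTop (𝓝 0)}

variable (X Y) in
/-- Lipschitz functions. -/
def LipFun : Set (X → Y) := {f | ∃ K : ℝ≥0, LipschitzWith K f}

variable (X Y) in
/-- Functions with bounded support. -/
def BddSupp : Set (X → Y) := {f | ∃ R : ℝ, 0 < R ∧ ∀ x : X, R < ‖x‖ → f x = 0}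

variable (X Y) in
/-- Functions of class `C^k` (in the Fréchet sense, over the reals), `k ∈ ℕ ∪ {∞}`. -/
def CkFun [NormedSpace ℝ X] [NormedSpace ℝ Y] (k : ℕ∞) : Set (X → Y) :=
  {f | ContDiff ℝ (k : WithTop ℕ∞) f}

variable (X) in
/-- `X` admits a real-valued `C^k` and Lipschitz bump: a nonzero `C^k`, Lipschitz function with
bounded support. -/
def HasCkLipBump [NormedSpace ℝ X] (k : ℕ∞) : Prop :=
  ∃ b : X → ℝ, b ≠ 0 ∧ b ∈ CkFun X ℝ k ∩ LipFun X ℝ ∩ BddSupp X ℝ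

end VanishingHolder

/-! Closure inside the vanishing spaces: since `t / ω t → 0`, Lipschitz functions vanish at small
scales; since `ω → ∞`, bounded ones vanish at large scales; bounded support gives far vanishing.
Each condition survives limits in the seminorm.

Density is a chain of three approximations. (a) A function in `VC` is clamped between `-φ` and `φ`
for a very flat cutoff `φ` (`exists_bddSupp_approx`). (b) A function vanishing at small scales is
replaced by its infimal convolution with a multiple of the norm, which is Lipschitz and close in
seminorm (`exists_lipBound_approx`). (c) A Lipschitz function is approximated uniformly by `C^k`
functions whose Lipschitz constant does not depend on the precision
(`HasCkLipBump.exists_approx_of_lipBound`). Short distances are then handled by the Lipschitz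
constants and long ones by uniform closeness.

For (c) no partition of unity is used. It suffices to approximate 1-Lipschitz functions up to some
fixed error, because rescaling makes that error small. Suprema of smooth functions are taken with a
smooth maximum that loses at most 1 and is exact when the new term is no larger. The bump yields a
smooth Lipschitz substitute for the norm, and a McShane-type supremum over a dense sequence does the
rest, with penalties making it locally finite. -/

namespace VanishingHolder

/-! ### Smooth ramp and smooth maximum of two numbers -/

/-- A smooth, nondecreasing, `1`-Lipschitz approximation of the positive part. -/
noncomputable def smoothRamp (t : ℝ) : ℝ := ∫ x in (0 : ℝ)..t, Real.smoothTransition x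

theorem hasDerivAt_smoothRamp (t : ℝ) :
    HasDerivAt smoothRamp (Real.smoothTransition t) t :=
  intervalIntegral.integral_hasDerivAt_right
    (Real.smoothTransition.continuous.intervalIntegrable _ _)
    (Real.smoothTransition.continuous.stronglyMeasurableAtFilter _ _)
    Real.smoothTransition.continuous.continuousAt

theorem contDiff_smoothRamp {n : ℕ∞} : ContDiff ℝ n smoothRamp := by
  have h : ContDiff ℝ (⊤ : ℕ∞) smoothRamp := by
    rw [contDiff_infty_iff_deriv]
    refine ⟨fun t => (hasDerivAt_smoothRamp t).differentiableAt, ?_⟩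
    rw [show deriv smoothRamp = Real.smoothTransition from
      funext fun t => (hasDerivAt_smoothRamp t).deriv]
    exact Real.smoothTransition.contDiff
  exact h.of_le (by exact_mod_cast le_top)

theorem smoothRamp_of_nonpos {t : ℝ} (ht : t ≤ 0) : smoothRamp t = 0 := by
  unfold smoothRamp
  rw [intervalIntegral.integral_congr (g := fun _ => (0 : ℝ)), intervalIntegral.integral_zero]
  intro x hx
  rw [Set.uIcc_of_ge ht] at hx
  exact Real.smoothTransition.zero_of_nonpos hx.2

theorem monotone_smoothRamp : Monotone smoothRamp :=
  monotone_of_deriv_nonneg (fun t => (hasDerivAt_smoothRamp t).differentiableAt) fun t => by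
    rw [(hasDerivAt_smoothRamp t).deriv]; exact Real.smoothTransition.nonneg t

theorem smoothRamp_nonneg (t : ℝ) : 0 ≤ smoothRamp t := by
  rcases le_total t 0 with h | h
  · exact (smoothRamp_of_nonpos h).ge
  · exact (smoothRamp_of_nonpos le_rfl).ge.trans (monotone_smoothRamp h)

theorem smoothRamp_sub_le {a b : ℝ} (hab : a ≤ b) : smoothRamp b - smoothRamp a ≤ b - a := by
  have hd : ∀ t, HasDerivAt (fun t => t - smoothRamp t) (1 - Real.smoothTransition t) t :=
    fun t => (hasDerivAt_id t).sub (hasDerivAt_smoothRamp t)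
  have hm : Monotone fun t => t - smoothRamp t :=
    monotone_of_deriv_nonneg (fun t => (hd t).differentiableAt) fun t => by
      rw [(hd t).deriv]; linarith [Real.smoothTransition.le_one t]
  have := hm hab
  simp only at this
  linarith

theorem abs_smoothRamp_sub_le (a b : ℝ) : |smoothRamp a - smoothRamp b| ≤ |a - b| := by
  rcases le_total a b with h | h
  · rw [abs_sub_comm, abs_of_nonneg (sub_nonneg.2 (monotone_smoothRamp h)), abs_sub_comm,
      abs_of_nonneg (sub_nonneg.2 h)]
    exact smoothRamp_sub_le h
  · rw [abs_of_nonneg (sub_nonneg.2 (monotone_smoothRamp h)), abs_of_nonneg (sub_nonneg.2 h)]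
    exact smoothRamp_sub_le h

theorem smoothRamp_le {t : ℝ} (ht : 0 ≤ t) : smoothRamp t ≤ t := by
  simpa [smoothRamp_of_nonpos le_rfl] using smoothRamp_sub_le ht

theorem sub_one_le_smoothRamp (t : ℝ) : t - 1 ≤ smoothRamp t := by
  rcases le_total t 1 with h | h
  · linarith [smoothRamp_nonneg t]
  · have : smoothRamp t - smoothRamp 1 = t - 1 := by
      unfold smoothRamp
      rw [intervalIntegral.integral_interval_sub_left
        (Real.smoothTransition.continuous.intervalIntegrable _ _)
        (Real.smoothTransition.continuous.intervalIntegrable _ _),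
        intervalIntegral.integral_congr (g := fun _ => (1 : ℝ))]
      · simp
      · intro x hx
        rw [Set.uIcc_of_le h] at hx
        exact Real.smoothTransition.one_of_one_le hx.1
    linarith [smoothRamp_nonneg 1]

/-- A smooth approximation of the maximum of two numbers. -/
noncomputable def smoothMax (a b : ℝ) : ℝ := a + smoothRamp (b - a)

theorem le_smoothMax_left (a b : ℝ) : a ≤ smoothMax a b := by
  unfold smoothMax; linarith [smoothRamp_nonneg (b - a)]

theorem sub_one_le_smoothMax (a b : ℝ) : b - 1 ≤ smoothMax a b := by
  unfold smoothMax; linarith [sub_one_le_smoothRamp (b - a)]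

/-- Exactness on this side is what lets iterated smooth maxima become locally constant in the index,
hence smooth in the limit. -/
theorem smoothMax_of_le {a b : ℝ} (h : b ≤ a) : smoothMax a b = a := by
  simp [smoothMax, smoothRamp_of_nonpos (sub_nonpos.2 h)]

theorem smoothMax_le {a b c : ℝ} (ha : a ≤ c) (hb : b ≤ c) : smoothMax a b ≤ c := by
  rcases le_total b a with h | h
  · rwa [smoothMax_of_le h]
  · unfold smoothMax; linarith [smoothRamp_le (sub_nonneg.2 h)]

/-- The ramp has slope in `[0, 1]`, so the smooth maximum is monotone in both arguments and commutes
with adding constants. Lipschitz constants therefore do not grow under iteration. -/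
theorem smoothMax_le_add {a b a' b' d : ℝ} (ha : a ≤ a' + d) (hb : b ≤ b' + d) :
    smoothMax a b ≤ smoothMax a' b' + d := by
  have h1 : smoothRamp (b - a) ≤ smoothRamp (b' + d - a) := monotone_smoothRamp (by linarith)
  have h2 := smoothRamp_sub_le (show b' - a' ≤ b' + d - a by linarith)
  unfold smoothMax
  linarith

/-! ### Smooth suprema of sequences of functions -/

section SmoothSup

variable {X : Type*}

/-- Iterated smooth maximum of `v, u 0, …, u (n - 1)`. -/
noncomputable def smoothSup (v : X → ℝ) (u : ℕ → X → ℝ) : ℕ → X → ℝ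
  | 0 => v
  | n + 1 => fun x => smoothMax (smoothSup v u n x) (u n x)

variable (v : X → ℝ) (u : ℕ → X → ℝ)

theorem monotone_smoothSup (x : X) : Monotone fun n => smoothSup v u n x :=
  monotone_nat_of_le_succ fun _ => le_smoothMax_left _ _

theorem le_smoothSup (n : ℕ) (x : X) : v x ≤ smoothSup v u n x :=
  monotone_smoothSup v u x (Nat.zero_le n)

theorem sub_one_le_smoothSup {i n : ℕ} (hi : i < n) (x : X) : u i x - 1 ≤ smoothSup v u n x :=
  (sub_one_le_smoothMax _ _).trans (monotone_smoothSup v u x (Nat.succ_le_of_lt hi))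

variable {v u}

theorem smoothSup_le {n : ℕ} {x : X} {B : ℝ} (hv : v x ≤ B) (hu : ∀ i < n, u i x ≤ B) :
    smoothSup v u n x ≤ B := by
  induction n with
  | zero => exact hv
  | succ n ih => exact smoothMax_le (ih fun i hi => hu i (by omega)) (hu n (by omega))

theorem smoothSup_eq_of_le {m n : ℕ} {x : X} (h : ∀ i, m ≤ i → u i x ≤ smoothSup v u i x)
    (hmn : m ≤ n) : smoothSup v u n x = smoothSup v u m x := by
  induction n, hmn using Nat.le_induction with
  | base => rfl
  | succ n hn ih => rw [← ih]; exact smoothMax_of_le (h n hn)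

variable [NormedAddCommGroup X]

/-- Lipschitz continuity of a real function with a real constant. -/
def LipBound (M : ℝ) (f : X → ℝ) : Prop := ∀ x y, |f x - f y| ≤ M * ‖x - y‖

theorem LipBound.le_add {M : ℝ} {f : X → ℝ} (h : LipBound M f) (x y : X) :
    f x ≤ f y + M * ‖x - y‖ := by linarith [(abs_le.1 (h x y)).2]

theorem lipBound_of_le_add {M : ℝ} {f : X → ℝ} (h : ∀ x y, f x ≤ f y + M * ‖x - y‖) :
    LipBound M f := fun x y => abs_le.2
  ⟨by have := h y x; rw [norm_sub_rev] at this; linarith, by linarith [h x y]⟩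

theorem LipBound.mem_lipFun {M : ℝ} {f : X → ℝ} (h : LipBound M f) : f ∈ LipFun X ℝ :=
  ⟨M.toNNReal, LipschitzWith.of_dist_le_mul fun x y => by
    rw [Real.dist_eq, dist_eq_norm]
    exact (h x y).trans (mul_le_mul_of_nonneg_right (Real.le_coe_toNNReal M) (norm_nonneg _))⟩

theorem exists_lipBound_of_mem_lipFun {f : X → ℝ} (h : f ∈ LipFun X ℝ) :
    ∃ M, 0 ≤ M ∧ LipBound M f := by
  obtain ⟨K, hK⟩ := h
  exact ⟨K, K.2, fun x y => by simpa [Real.dist_eq, dist_eq_norm] using hK.dist_le_mul x y⟩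

theorem lipBound_smoothSup {M : ℝ} (hv : LipBound M v) (hu : ∀ n, LipBound M (u n)) (n : ℕ) :
    LipBound M (smoothSup v u n) := by
  induction n with
  | zero => exact hv
  | succ n ih =>
    exact lipBound_of_le_add fun x y => smoothMax_le_add (ih.le_add x y) ((hu n).le_add x y)

variable [NormedSpace ℝ X] {k : ℕ∞}

theorem contDiff_smoothSup (hv : ContDiff ℝ k v) (hu : ∀ n, ContDiff ℝ k (u n)) (n : ℕ) :
    ContDiff ℝ k (smoothSup v u n) := by
  induction n with
  | zero => exact hv
  | succ n ih => exact ih.add (contDiff_smoothRamp.comp ((hu n).sub ih))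

/-- Under `hstab` all terms from index `m` on are absorbed near `x`, so the limit coincides there
with one finite smooth supremum. -/
theorem exists_contDiff_lim_smoothSup {M : ℝ} (hv : ContDiff ℝ k v)
    (hu : ∀ n, ContDiff ℝ k (u n)) (hvM : LipBound M v) (huM : ∀ n, LipBound M (u n))
    (hstab : ∀ x, ∃ m, ∀ᶠ y in 𝓝 x, ∀ i, m ≤ i → u i y ≤ smoothSup v u i y) :
    ∃ g : X → ℝ, ContDiff ℝ k g ∧ LipBound M g ∧
      ∀ x, ∃ m, ∀ n, m ≤ n → g x = smoothSup v u n x := by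
  choose m hm using hstab
  have hself : ∀ x n, m x ≤ n → smoothSup v u (m x) x = smoothSup v u n x := fun x n hn =>
    (smoothSup_eq_of_le (hm x).self_of_nhds hn).symm
  refine ⟨fun x => smoothSup v u (m x) x, ?_, ?_, fun x => ⟨m x, hself x⟩⟩
  · refine contDiff_iff_contDiffAt.2 fun x => ?_
    refine (contDiff_smoothSup hv hu (m x)).contDiffAt.congr_of_eventuallyEq ?_
    filter_upwards [hm x] with y hy
    rw [hself y _ (le_max_left _ (m x)), smoothSup_eq_of_le hy (le_max_right _ _)]
  · intro x y
    simp only [hself x _ (le_max_left _ (m y)), hself y _ (le_max_right (m x) _)]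
    exact lipBound_smoothSup hvM huM _ x y

end SmoothSup

/-! ### Uniform `C^k` Lipschitz approximation from a bump -/

section SmoothApproximation

variable {X : Type*} [NormedAddCommGroup X] [NormedSpace ℝ X] {k : ℕ∞}

/-- Recentre and normalise the bump to be 1 at the origin. The ramp of `3 * (1 - b) - 1` is zero
where the bump is at least `2/3`, and at least 1 where it vanishes, the argument there being 2. -/
theorem HasCkLipBump.exists_vanishing_near_zero (hb : HasCkLipBump X k) :
    ∃ (q : X → ℝ) (M r R : ℝ), ContDiff ℝ k q ∧ LipBound M q ∧ 0 ≤ M ∧ 0 < r ∧ 0 < R ∧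
      (∀ x, ‖x‖ ≤ r → q x = 0) ∧ ∀ x, R ≤ ‖x‖ → 1 ≤ q x := by
  obtain ⟨b, hb0, ⟨hbC, hbL⟩, R, hR, hbR⟩ := hb
  obtain ⟨x₀, hx₀⟩ := Function.ne_iff.1 hb0
  obtain ⟨L, hL, hbL⟩ := exists_lipBound_of_mem_lipFun hbL
  simp only [Pi.zero_apply] at hx₀
  have hc : 0 < |b x₀| := abs_pos.2 hx₀
  have hlip : ∀ x y, |b (x + x₀) / b x₀ - b (y + x₀) / b x₀| ≤ L / |b x₀| * ‖x - y‖ := by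
    intro x y
    rw [← sub_div, abs_div, div_mul_eq_mul_div]
    gcongr
    simpa using hbL (x + x₀) (y + x₀)
  have hM : 0 ≤ L / |b x₀| := by positivity
  refine ⟨fun x => smoothRamp (3 * (1 - b (x + x₀) / b x₀) - 1), 3 * (L / |b x₀|),
    1 / (3 * (L / |b x₀| + 1)), R + ‖x₀‖ + 1, ?_, ?_, by positivity, by positivity,
    by positivity, ?_, ?_⟩
  · have hbC' : ContDiff ℝ k b := hbC
    exact contDiff_smoothRamp.comp (by fun_prop)
  · intro x y
    refine (abs_smoothRamp_sub_le _ _).trans ?_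
    rw [show 3 * (1 - b (x + x₀) / b x₀) - 1 - (3 * (1 - b (y + x₀) / b x₀) - 1)
      = 3 * -(b (x + x₀) / b x₀ - b (y + x₀) / b x₀) by ring, abs_mul, abs_neg, mul_assoc]
    norm_num
    exact hlip x y
  · intro x hx
    apply smoothRamp_of_nonpos
    have h := (abs_le.1 (hlip x 0)).1
    simp only [zero_add, div_self hx₀, sub_zero] at h
    rw [le_div_iff₀ (by positivity)] at hx
    nlinarith [norm_nonneg x]
  · intro x hx
    have h0 : b (x + x₀) = 0 := hbR _ (by
      have := norm_sub_le (x + x₀) x₀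
      rw [add_sub_cancel_right] at this
      linarith)
    have := sub_one_le_smoothRamp 2
    norm_num [h0]
    linarith

/-- The dilates `2 ^ n * q (2⁻ⁿ x)` share one Lipschitz constant, vanish for `‖x‖ ≤ 2 ^ n * r` and
are at least `2 ^ n` for `‖x‖ ≥ 2 ^ n * R`. Their smooth supremum is thus locally finite and
comparable to the norm up to an additive constant. -/
theorem HasCkLipBump.exists_coarse_norm (hb : HasCkLipBump X k) :
    ∃ (Ψ : X → ℝ) (M K : ℝ), ContDiff ℝ k Ψ ∧ LipBound M Ψ ∧ 0 ≤ M ∧ 0 ≤ K ∧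
      (∀ x, Ψ x ≤ M * ‖x‖) ∧ ∀ x, ‖x‖ - K ≤ Ψ x := by
  obtain ⟨q, M, r, R, hqC, hqL, hM, hr, hR, hq0, hq1⟩ := hb.exists_vanishing_near_zero
  set u : ℕ → X → ℝ := fun n x => 2 ^ n * q (((2 : ℝ) ^ n)⁻¹ • x) with hu
  have huC : ∀ n, ContDiff ℝ k (u n) := fun n => by
    simp only [hu]; fun_prop
  have huL : ∀ n, LipBound M (u n) := by
    intro n x y
    simp only [hu]
    rw [← mul_sub, abs_mul, abs_of_pos (by positivity : (0 : ℝ) < 2 ^ n)]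
    have := hqL (((2 : ℝ) ^ n)⁻¹ • x) (((2 : ℝ) ^ n)⁻¹ • y)
    rw [← smul_sub, norm_smul, Real.norm_of_nonneg (by positivity)] at this
    calc _ ≤ 2 ^ n * (M * ((2 ^ n)⁻¹ * ‖x - y‖)) := by gcongr
      _ = M * ‖x - y‖ := by field_simp
  have hzero : LipBound M (fun _ : X => (0 : ℝ)) := fun x y => by simp; positivity
  obtain ⟨g, hgC, hgL, hg⟩ := exists_contDiff_lim_smoothSup (v := fun _ => 0) (u := u)
    contDiff_const huC hzero huL (by
      intro x
      obtain ⟨m, hm⟩ := pow_unbounded_of_one_lt ((‖x‖ + 1) / r) (one_lt_two)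
      refine ⟨m, ?_⟩
      filter_upwards [Metric.ball_mem_nhds x one_pos] with y hy i hi
      refine le_trans (le_of_eq ?_) (le_smoothSup _ _ i y)
      have hy' : ‖y‖ ≤ ‖x‖ + 1 := by
        have := norm_sub_norm_le y x
        rw [mem_ball_iff_norm] at hy
        linarith
      have h2 : (2 : ℝ) ^ m ≤ 2 ^ i := pow_le_pow_right₀ one_le_two hi
      have : q (((2 : ℝ) ^ i)⁻¹ • y) = 0 := by
        apply hq0
        rw [norm_smul, Real.norm_of_nonneg (by positivity), inv_mul_le_iff₀ (by positivity)]
        rw [div_lt_iff₀ hr] at hm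
        nlinarith
      simp [hu, this])
  have hg0 : ∀ x, 0 ≤ g x := fun x => by
    obtain ⟨m, hm⟩ := hg x
    rw [hm m le_rfl]; exact le_smoothSup (fun _ => 0) u m x
  have hg00 : g 0 ≤ 0 := by
    obtain ⟨m, hm⟩ := hg 0
    rw [hm m le_rfl]
    exact smoothSup_le le_rfl fun i _ => by simp [hu, hq0 0 (by simpa using hr.le)]
  have hglow : ∀ x, ‖x‖ - 2 * R ≤ 2 * R * g x := by
    intro x
    rcases lt_or_ge ‖x‖ R with h | h
    · nlinarith [hg0 x, mul_nonneg hR.le (hg0 x)]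
    · obtain ⟨n, hn1, hn2⟩ := exists_nat_pow_near ((one_le_div hR).2 h) (one_lt_two (α := ℝ))
      obtain ⟨m, hm⟩ := hg x
      have h1 : 1 ≤ q (((2 : ℝ) ^ n)⁻¹ • x) := by
        apply hq1
        rw [norm_smul, Real.norm_of_nonneg (by positivity), le_inv_mul_iff₀ (by positivity)]
        rwa [le_div_iff₀ hR] at hn1
      have h2 : (2 : ℝ) ^ n - 1 ≤ g x := by
        rw [hm _ (le_max_left m (n + 1))]
        refine le_trans ?_ (sub_one_le_smoothSup (fun _ => 0) u (i := n) (by omega) x)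
        have : (2 : ℝ) ^ n ≤ u n x := le_mul_of_one_le_right (by positivity) h1
        linarith
      rw [div_lt_iff₀ hR, pow_succ] at hn2
      nlinarith
  refine ⟨fun x => 2 * R * g x, 2 * R * M, 2 * R, by fun_prop, ?_, by positivity, by positivity,
    ?_, hglow⟩
  · intro x y
    rw [← mul_sub, abs_mul, abs_of_pos (by positivity)]
    exact (mul_le_mul_of_nonneg_left (hgL x y) (by positivity)).trans_eq (by ring)
  · intro x
    have := hgL.le_add x 0
    rw [sub_zero] at this
    exact (mul_le_mul_of_nonneg_left (show g x ≤ M * ‖x‖ by linarith)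
      (by positivity : 0 ≤ 2 * R)).trans_eq (by ring)

/-- Uniformly close smooth Lipschitz approximation of nonexpansive functions. -/
theorem HasCkLipBump.exists_approx [TopologicalSpace.SeparableSpace X] (hb : HasCkLipBump X k) :
    ∃ M K : ℝ, 0 ≤ M ∧ 0 ≤ K ∧ ∀ h : X → ℝ, LipBound 1 h →
      ∃ g : X → ℝ, ContDiff ℝ k g ∧ LipBound M g ∧ ∀ x, |g x - h x| ≤ K := by
  obtain ⟨Ψ, M, K, hΨC, hΨL, hM, hK, hΨu, hΨl⟩ := hb.exists_coarse_norm
  refine ⟨4 * M, 5 * K + 21, by positivity, by positivity, fun h hh => ?_⟩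
  -- Chosen so that `K - 3 * (A - 3) ≤ -(2 * A + K + 1)`: a fully penalised term then lies below the
  -- guaranteed lower bound. The error `5 * K + 21` is `2 * A + K + 1`.
  set A : ℝ := 2 * K + 10 with hA
  set a : ℕ → X := TopologicalSpace.denseSeq X
  have hd : DenseRange a := TopologicalSpace.denseRange_denseSeq X
  set e : ℕ → X → ℝ := fun n x => -Ψ (x - a n) with he
  set W := smoothSup (fun _ => -A) e with hW
  -- `W n` measures how close the earlier centres come to `x`, and the penalty removes the `n`-th
  -- term once one of them is close. The factor 3 must exceed 2 to outweigh the loss `2 * A` in the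
  -- lower bound; it also accounts for the Lipschitz constant `M + 3 * M`.
  set u : ℕ → X → ℝ := fun n x => h (a n) + e n x - 3 * smoothRamp (W n x + A) with hu
  have heC : ∀ n, ContDiff ℝ k (e n) := fun n => by simp only [he]; fun_prop
  have heL : ∀ n, LipBound M (e n) := fun n x y => by
    have := hΨL (y - a n) (x - a n)
    rw [sub_sub_sub_cancel_right, norm_sub_rev] at this
    simpa only [he, neg_sub_neg] using this
  have hWC : ∀ n, ContDiff ℝ k (W n) := contDiff_smoothSup contDiff_const heC
  have hWL : ∀ n, LipBound M (W n) :=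
    lipBound_smoothSup (fun x y => by simp; positivity) heL
  have huC : ∀ n, ContDiff ℝ k (u n) := fun n =>
    (contDiff_const.add (heC n)).sub
      (contDiff_const.mul (contDiff_smoothRamp.comp ((hWC n).add contDiff_const)))
  have huL : ∀ n, LipBound (4 * M) (u n) := fun n => lipBound_of_le_add fun x y => by
    have h1 := (heL n).le_add x y
    have h2 := (abs_le.1 (abs_smoothRamp_sub_le (W n x + A) (W n y + A))).1
    have h3 := hWL n x y
    rw [add_sub_add_right_eq_sub] at h2
    simp only [hu]
    linarith
  have hhl : ∀ n x, h (a n) ≤ h x + ‖x - a n‖ := fun n x => by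
    have := hh.le_add (a n) x
    rwa [one_mul, norm_sub_rev] at this
  have hhu : ∀ n x, h x ≤ h (a n) + ‖x - a n‖ := fun n x => by
    simpa using hh.le_add x (a n)
  have hub : ∀ n x, u n x ≤ h x + K - 3 * smoothRamp (W n x + A) := fun n x => by
    simp only [hu, he]
    linarith [hhl n x, hΨl (x - a n)]
  have hub' : ∀ n x, u n x ≤ h x + K := fun n x => by
    linarith [hub n x, smoothRamp_nonneg (W n x + A)]
  -- lower bound as soon as the dense sequence has come close to `x`
  have hlow : ∀ x m, -A < e m x → ∀ n, m < n → h x - (2 * A + K + 1) ≤ smoothSup (u 0) u n x := by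
    intro x m hm n hn
    classical
    have hex : ∃ i, -A < e i x := ⟨m, hm⟩
    -- At the first centre within range no earlier centre has triggered the penalty, so this term
    -- enters in full.
    set i := Nat.find hex
    have hi : -A < e i x := Nat.find_spec hex
    have him : i ≤ m := Nat.find_min' hex hm
    have hWi : W i x ≤ -A := smoothSup_le le_rfl fun j hj => not_lt.1 (Nat.find_min hex hj)
    have h1 := sub_one_le_smoothSup (u 0) u (show i < n by omega) x
    have h2 : smoothRamp (W i x + A) = 0 := smoothRamp_of_nonpos (by linarith)
    simp only [hu, h2] at h1
    have h3 := hΨl (x - a i)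
    have h4 := hhu i x
    simp only [he] at hi h1
    linarith
  have hnear : ∀ x, ∃ m, ∀ᶠ y in 𝓝 x, -1 ≤ e m y := by
    intro x
    obtain ⟨m, hm⟩ := hd.exists_dist_lt x (show (0 : ℝ) < 1 / (M + 1) by positivity)
    refine ⟨m, ?_⟩
    filter_upwards [Metric.isOpen_ball.mem_nhds (show x ∈ Metric.ball (a m) (1 / (M + 1)) from hm)]
      with y hy
    rw [mem_ball_iff_norm, lt_div_iff₀ (by positivity)] at hy
    have := hΨu (y - a m)
    simp only [he]
    nlinarith [norm_nonneg (y - a m)]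
  obtain ⟨g, hgC, hgL, hg⟩ := exists_contDiff_lim_smoothSup (huC 0) huC (huL 0) huL (by
    intro x
    obtain ⟨m, hm⟩ := hnear x
    refine ⟨m + 1, ?_⟩
    filter_upwards [hm] with y hy i hi
    refine le_trans ?_ (hlow y m (by linarith) i (by omega))
    have h1 := sub_one_le_smoothSup (fun _ => -A) e (show m < i by omega) y
    have h2 := sub_one_le_smoothRamp (W i y + A)
    have h3 := hub i y
    rw [← hW] at h1
    linarith)
  refine ⟨g, hgC, hgL, fun x => ?_⟩
  obtain ⟨n, hn⟩ := hg x
  obtain ⟨m, hm⟩ := hnear x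
  rw [hn _ (le_max_left n (m + 1))]
  have h1 := hlow x m (by linarith [hm.self_of_nhds]) (max n (m + 1)) (by omega)
  have h2 : smoothSup (u 0) u (max n (m + 1)) x ≤ h x + K :=
    smoothSup_le (hub' 0 x) fun i _ => hub' i x
  rw [abs_le]
  constructor <;> linarith

/-- Smooth Lipschitz approximation with arbitrary precision and controlled constant. -/
theorem HasCkLipBump.exists_approx_of_lipBound [TopologicalSpace.SeparableSpace X]
    (hb : HasCkLipBump X k) {L : ℝ} (hL : 0 < L) {h : X → ℝ} (hh : LipBound L h) :
    ∃ M : ℝ, 0 ≤ M ∧ ∀ η : ℝ, 0 < η →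
      ∃ g : X → ℝ, ContDiff ℝ k g ∧ LipBound M g ∧ ∀ x, |g x - h x| ≤ η := by
  obtain ⟨M, K, hM, hK, H⟩ := hb.exists_approx
  refine ⟨L * M, by positivity, fun η hη => ?_⟩
  -- Conjugating by the dilation of ratio `s` scales the fixed error `K` to `s * L * K ≤ η` and
  -- leaves the Lipschitz constant `L * M` independent of `η`.
  set s : ℝ := η / (L * (K + 1)) with hs
  have hspos : 0 < s := by positivity
  obtain ⟨g, hgC, hgL, hg⟩ := H (fun x => (s * L)⁻¹ * h (s • x)) (fun x y => by
    rw [← mul_sub, abs_mul, abs_of_pos (by positivity), inv_mul_le_iff₀ (by positivity)]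
    refine (hh _ _).trans (le_of_eq ?_)
    rw [← smul_sub, norm_smul, Real.norm_of_nonneg hspos.le]
    ring)
  refine ⟨fun x => s * L * g (s⁻¹ • x), by fun_prop, fun x y => ?_, fun x => ?_⟩
  · rw [← mul_sub, abs_mul, abs_of_pos (by positivity)]
    have := hgL (s⁻¹ • x) (s⁻¹ • y)
    rw [← smul_sub, norm_smul, Real.norm_of_nonneg (by positivity)] at this
    calc _ ≤ s * L * (M * (s⁻¹ * ‖x - y‖)) := by gcongr
      _ = L * M * ‖x - y‖ := by field_simp
  · have := hg (s⁻¹ • x)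
    rw [smul_inv_smul₀ hspos.ne'] at this
    rw [show s * L * g (s⁻¹ • x) - h x = s * L * (g (s⁻¹ • x) - (s * L)⁻¹ * h x) by
      field_simp, abs_mul, abs_of_pos (by positivity)]
    calc _ ≤ s * L * K := by gcongr
      _ = η * (K / (K + 1)) := by rw [hs]; field_simp
      _ ≤ η * 1 := by gcongr; rw [div_le_one (by positivity)]; linarith
      _ = η := mul_one η

end SmoothApproximation

/-! ### Real inequalities for the seminorm and the vanishing conditions -/

section Translation

variable {X : Type*} [NormedAddCommGroup X] {ω : ℝ → ℝ} {f : X → ℝ}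

/-- The bound `|f x - f y| ≤ c ω(‖x - y‖)` for distinct points. -/
def HolderBound (ω : ℝ → ℝ) (c : ℝ) (f : X → ℝ) : Prop :=
  ∀ x y, x ≠ y → |f x - f y| ≤ c * ω ‖x - y‖

theorem IsModulus.norm_sub_pos (hω : IsModulus ω) {x y : X} (h : x ≠ y) : 0 < ω ‖x - y‖ :=
  hω.pos (norm_sub_pos_iff.2 h)

theorem IsModulus.mono (hω : IsModulus ω) {s t : ℝ} (hs : 0 < s) (hst : s ≤ t) : ω s ≤ ω t :=
  hω.monotoneOn hs (hs.trans_le hst) hst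

theorem oscPair_le_ofReal_iff (hω : IsModulus ω) {x y : X} (h : x ≠ y) {c : ℝ} (hc : 0 ≤ c) :
    oscPair ω f x y ≤ ENNReal.ofReal c ↔ |f x - f y| ≤ c * ω ‖x - y‖ := by
  have hp := hω.norm_sub_pos h
  rw [oscPair, ENNReal.div_le_iff (by simpa using hp) ENNReal.ofReal_ne_top,
    ← ENNReal.ofReal_mul hc, Real.enorm_eq_ofReal_abs, ENNReal.ofReal_le_ofReal_iff]
  positivity

theorem holderSeminorm_le_ofReal_iff (hω : IsModulus ω) {c : ℝ} (hc : 0 ≤ c) :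
    holderSeminorm ω f ≤ ENNReal.ofReal c ↔ HolderBound ω c f := by
  simp only [holderSeminorm, iSup_le_iff, HolderBound]
  exact forall_congr' fun x => forall_congr' fun y => forall_congr' fun h =>
    oscPair_le_ofReal_iff hω h hc

theorem HolderBound.mono (hω : IsModulus ω) {c d : ℝ} (h : HolderBound ω c f) (hcd : c ≤ d) :
    HolderBound ω d f := fun x y hxy =>
  (h x y hxy).trans (mul_le_mul_of_nonneg_right hcd (hω.norm_sub_pos hxy).le)

theorem mem_holderSpace_iff (hω : IsModulus ω) :
    f ∈ HolderSpace X ℝ ω ↔ ∃ c, 0 ≤ c ∧ HolderBound ω c f := by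
  constructor
  · intro h
    refine ⟨(holderSeminorm ω f).toReal, ENNReal.toReal_nonneg, ?_⟩
    rw [← holderSeminorm_le_ofReal_iff hω ENNReal.toReal_nonneg]
    exact (ENNReal.ofReal_toReal (ne_of_lt h)).ge
  · rintro ⟨c, hc, h⟩
    exact ((holderSeminorm_le_ofReal_iff hω hc).2 h).trans_lt ENNReal.ofReal_lt_top

theorem tendsto_zero_iff_ofReal {α : Type*} {l : Filter α} {φ : α → ℝ≥0∞} :
    Tendsto φ l (𝓝 0) ↔ ∀ ε : ℝ, 0 < ε → ∀ᶠ a in l, φ a ≤ ENNReal.ofReal ε := by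
  rw [ENNReal.tendsto_nhds_zero]
  constructor
  · exact fun h ε hε => h _ (ENNReal.ofReal_pos.2 hε)
  · intro h ε hε
    obtain ⟨r, -, hr⟩ := ENNReal.lt_iff_exists_real_btwn.1 hε
    filter_upwards [h r (ENNReal.ofReal_pos.1 hr.1)] with a ha using ha.trans hr.2.le

theorem mem_vSmall_iff (hω : IsModulus ω) :
    f ∈ VSmall X ℝ ω ↔ ∀ ε : ℝ, 0 < ε → ∃ δ : ℝ, 0 < δ ∧
      ∀ x y, x ≠ y → ‖x - y‖ < δ → |f x - f y| ≤ ε * ω ‖x - y‖ := by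
  rw [VSmall, Set.mem_ofPred_eq, tendsto_zero_iff_ofReal]
  refine forall₂_congr fun ε hε => ?_
  rw [eventually_nhdsWithin_iff, Metric.eventually_nhds_iff]
  refine exists_congr fun δ => and_congr_right fun hδ => ?_
  simp only [oscAt, iSup_le_iff, Real.dist_0_eq_abs]
  constructor
  · intro h x y hxy hlt
    exact (oscPair_le_ofReal_iff hω hxy hε.le).1
      (h (by rwa [abs_norm]) (norm_sub_pos_iff.2 hxy) x y hxy rfl)
  · rintro h t ht ht0 x y hxy rfl
    exact (oscPair_le_ofReal_iff hω hxy hε.le).2 (h x y hxy (by rwa [abs_norm] at ht))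

theorem mem_vLarge_iff (hω : IsModulus ω) :
    f ∈ VLarge X ℝ ω ↔ ∀ ε : ℝ, 0 < ε → ∃ D : ℝ,
      ∀ x y, x ≠ y → D ≤ ‖x - y‖ → |f x - f y| ≤ ε * ω ‖x - y‖ := by
  rw [VLarge, Set.mem_ofPred_eq, tendsto_zero_iff_ofReal]
  refine forall₂_congr fun ε hε => ?_
  rw [eventually_atTop]
  refine exists_congr fun D => ?_
  simp only [oscAt, iSup_le_iff]
  constructor
  · intro h x y hxy hlt
    exact (oscPair_le_ofReal_iff hω hxy hε.le).1 (h _ hlt x y hxy rfl)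
  · rintro h t ht x y hxy rfl
    exact (oscPair_le_ofReal_iff hω hxy hε.le).2 (h x y hxy ht)

theorem mem_vFar_iff (hω : IsModulus ω) :
    f ∈ VFar X ℝ ω ↔ ∀ ε : ℝ, 0 < ε → ∃ D : ℝ,
      ∀ x y, x ≠ y → D < ‖x‖ → D < ‖y‖ → |f x - f y| ≤ ε * ω ‖x - y‖ := by
  rw [VFar, Set.mem_ofPred_eq, tendsto_zero_iff_ofReal]
  refine forall₂_congr fun ε hε => ?_
  rw [eventually_atTop]
  refine exists_congr fun D => ?_
  simp only [oscFar, iSup_le_iff, lt_min_iff]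
  constructor
  · intro h x y hxy hx hy
    exact (oscPair_le_ofReal_iff hω hxy hε.le).1 (h D le_rfl x y hxy ⟨hx, hy⟩)
  · rintro h t ht x y hxy ⟨hx, hy⟩
    exact (oscPair_le_ofReal_iff hω hxy hε.le).2 (h x y hxy (by linarith) (by linarith))

theorem mem_holderClosure_iff (hω : IsModulus ω) {S : Set (X → ℝ)} :
    f ∈ holderClosure ω S ↔ f ∈ HolderSpace X ℝ ω ∧
      ∀ ε : ℝ, 0 < ε → ∃ g ∈ S, HolderBound ω ε fun x => g x - f x := by
  refine and_congr_right fun _ => ?_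
  constructor
  · rintro ⟨F, hF, hlim⟩ ε hε
    obtain ⟨n, hn⟩ := (tendsto_zero_iff_ofReal.1 hlim ε hε).exists
    exact ⟨F n, hF n, (holderSeminorm_le_ofReal_iff hω hε.le).1 hn⟩
  · intro h
    choose F hF hb using fun n : ℕ => h (1 / ((n : ℝ) + 1)) (by positivity)
    refine ⟨F, hF, tendsto_zero_iff_ofReal.2 fun ε hε => ?_⟩
    have := (tendsto_one_div_add_atTop_nhds_zero_nat (𝕜 := ℝ)).eventually_lt_const hε
    filter_upwards [this] with n hn
    exact (holderSeminorm_le_ofReal_iff hω hε.le).2 ((hb n).mono hω hn.le)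

theorem HolderBound.add {g : X → ℝ} {c d : ℝ} (hf : HolderBound ω c f) (hg : HolderBound ω d g) :
    HolderBound ω (c + d) fun x => f x + g x := fun x y hxy => by
  rw [add_mul, add_sub_add_comm]
  exact (abs_add_le _ _).trans (add_le_add (hf x y hxy) (hg x y hxy))

theorem abs_sub_le_of_approx {X : Type*} {f g : X → ℝ} {x y : X} {a b : ℝ}
    (hg : |g x - g y| ≤ a) (hgf : |(g x - f x) - (g y - f y)| ≤ b) : |f x - f y| ≤ a + b := by
  rw [show f x - f y = (g x - g y) - ((g x - f x) - (g y - f y)) by ring]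
  exact (abs_sub _ _).trans (add_le_add hg hgf)

theorem IsModulus.exists_le_mul (hω : IsModulus ω) {M ε : ℝ} (hM : 0 ≤ M) (hε : 0 < ε) :
    ∃ δ : ℝ, 0 < δ ∧ ∀ t, 0 < t → t < δ → M * t ≤ ε * ω t := by
  have h := hω.tendsto_div.eventually_lt_const (show 0 < ε / (M + 1) by positivity)
  rw [eventually_nhdsWithin_iff, Metric.eventually_nhds_iff] at h
  obtain ⟨δ, hδ, h⟩ := h
  refine ⟨δ, hδ, fun t ht htδ => ?_⟩
  have h1 := h (by rwa [Real.dist_0_eq_abs, abs_of_pos ht]) ht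
  have hp := hω.pos ht
  rw [div_lt_div_iff₀ hp (by positivity)] at h1
  linarith

theorem LipBound.mem_vSmall (hω : IsModulus ω) {M : ℝ} (hM : 0 ≤ M) (hf : LipBound M f) :
    f ∈ VSmall X ℝ ω := by
  refine (mem_vSmall_iff hω).2 fun ε hε => ?_
  obtain ⟨δ, hδ, h⟩ := hω.exists_le_mul hM hε
  exact ⟨δ, hδ, fun x y hxy hlt => (hf x y).trans (h _ (norm_sub_pos_iff.2 hxy) hlt)⟩

theorem mem_vLarge_of_bounded (hω : IsModulus ω) {B : ℝ} (hf : ∀ x, |f x| ≤ B) :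
    f ∈ VLarge X ℝ ω := by
  refine (mem_vLarge_iff hω).2 fun ε hε => ?_
  obtain ⟨D, hD⟩ := eventually_atTop.1 (hω.tendsto_atTop.eventually_ge_atTop (2 * B / ε))
  refine ⟨D, fun x y _ h => ?_⟩
  have h1 := hD _ h
  rw [div_le_iff₀ hε] at h1
  have h2 := (abs_sub (f x) (f y)).trans (add_le_add (hf x) (hf y))
  linarith

theorem mem_vFar_of_mem_bddSupp (hω : IsModulus ω) (hf : f ∈ BddSupp X ℝ) :
    f ∈ VFar X ℝ ω := by
  obtain ⟨R, -, hR⟩ := hf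
  refine (mem_vFar_iff hω).2 fun ε hε => ⟨R, fun x y hxy hx hy => ?_⟩
  have := hω.norm_sub_pos hxy
  rw [hR x hx, hR y hy, sub_self, abs_zero]
  positivity

/-- The additive slack `A` covers functions that are Lipschitz only at large scales; `A = 0` is the
Lipschitz case. -/
theorem exists_bound_of_mem_bddSupp {A L : ℝ} (hA : 0 ≤ A) (hL : 0 ≤ L)
    (hf : ∀ x y, f x ≤ f y + (A + L * ‖x - y‖)) (hs : f ∈ BddSupp X ℝ) :
    ∃ B, 0 ≤ B ∧ ∀ x, |f x| ≤ B := by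
  obtain ⟨R, hR0, hR⟩ := hs
  refine ⟨|f 0| + (A + L * R), by positivity, fun x => ?_⟩
  rcases lt_or_ge R ‖x‖ with h | h
  · rw [hR x h, abs_zero]; positivity
  · have h1 := hf x 0
    have h2 := hf 0 x
    rw [sub_zero] at h1
    rw [zero_sub, norm_neg] at h2
    have h3 : L * ‖x‖ ≤ L * R := by gcongr
    have h4 := neg_abs_le (f 0)
    have h5 := le_abs_self (f 0)
    rw [abs_le]
    constructor <;> linarith

end Translation

/-! ### Stability of the vanishing conditions under seminorm limits -/

section Closure

variable {X : Type*} [NormedAddCommGroup X] {ω : ℝ → ℝ} {f : X → ℝ} {S : Set (X → ℝ)}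

theorem mem_vSmall_of_approx (hω : IsModulus ω)
    (h : ∀ ε : ℝ, 0 < ε → ∃ g ∈ VSmall X ℝ ω, HolderBound ω ε fun x => g x - f x) :
    f ∈ VSmall X ℝ ω := by
  refine (mem_vSmall_iff hω).2 fun ε hε => ?_
  obtain ⟨g, hg, hgf⟩ := h (ε / 2) (half_pos hε)
  obtain ⟨δ, hδ, H⟩ := (mem_vSmall_iff hω).1 hg (ε / 2) (half_pos hε)
  refine ⟨δ, hδ, fun x y hxy hlt => ?_⟩
  exact (abs_sub_le_of_approx (H x y hxy hlt) (hgf x y hxy)).trans_eq (by ring)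

theorem mem_vLarge_of_approx (hω : IsModulus ω)
    (h : ∀ ε : ℝ, 0 < ε → ∃ g ∈ VLarge X ℝ ω, HolderBound ω ε fun x => g x - f x) :
    f ∈ VLarge X ℝ ω := by
  refine (mem_vLarge_iff hω).2 fun ε hε => ?_
  obtain ⟨g, hg, hgf⟩ := h (ε / 2) (half_pos hε)
  obtain ⟨D, H⟩ := (mem_vLarge_iff hω).1 hg (ε / 2) (half_pos hε)
  refine ⟨D, fun x y hxy hlt => ?_⟩
  exact (abs_sub_le_of_approx (H x y hxy hlt) (hgf x y hxy)).trans_eq (by ring)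

theorem mem_vFar_of_approx (hω : IsModulus ω)
    (h : ∀ ε : ℝ, 0 < ε → ∃ g ∈ VFar X ℝ ω, HolderBound ω ε fun x => g x - f x) :
    f ∈ VFar X ℝ ω := by
  refine (mem_vFar_iff hω).2 fun ε hε => ?_
  obtain ⟨g, hg, hgf⟩ := h (ε / 2) (half_pos hε)
  obtain ⟨D, H⟩ := (mem_vFar_iff hω).1 hg (ε / 2) (half_pos hε)
  refine ⟨D, fun x y hxy hx hy => ?_⟩
  exact (abs_sub_le_of_approx (H x y hxy hx hy) (hgf x y hxy)).trans_eq (by ring)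

theorem holderClosure_subset_vcSmall (hω : IsModulus ω) (hS : S ⊆ LipFun X ℝ) :
    holderClosure ω S ⊆ VCSmall X ℝ ω := by
  intro f hf
  obtain ⟨hfH, h⟩ := (mem_holderClosure_iff hω).1 hf
  refine ⟨mem_vSmall_of_approx hω fun ε hε => ?_, hfH⟩
  obtain ⟨g, hg, hgf⟩ := h ε hε
  obtain ⟨M, hM, hgL⟩ := exists_lipBound_of_mem_lipFun (hS hg)
  exact ⟨g, hgL.mem_vSmall hω hM, hgf⟩

theorem holderClosure_subset_vc (hω : IsModulus ω) (hS : S ⊆ LipFun X ℝ)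
    (hS' : S ⊆ BddSupp X ℝ) : holderClosure ω S ⊆ VC X ℝ ω := by
  intro f hf
  obtain ⟨hfH, h⟩ := (mem_holderClosure_iff hω).1 hf
  refine ⟨⟨holderClosure_subset_vcSmall hω hS hf, mem_vFar_of_approx hω fun ε hε => ?_, hfH⟩,
    mem_vLarge_of_approx hω fun ε hε => ?_, hfH⟩
  · obtain ⟨g, hg, hgf⟩ := h ε hε
    exact ⟨g, mem_vFar_of_mem_bddSupp hω (hS' hg), hgf⟩
  · obtain ⟨g, hg, hgf⟩ := h ε hε
    obtain ⟨M, hM, hgL⟩ := exists_lipBound_of_mem_lipFun (hS hg)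
    obtain ⟨B, -, hB⟩ := exists_bound_of_mem_bddSupp le_rfl hM
      (fun x y => by simpa using hgL.le_add x y) (hS' hg)
    exact ⟨g, mem_vLarge_of_bounded hω hB, hgf⟩

end Closure

/-! ### Infimal convolution of a coarsely Lipschitz function -/

section InfConvolution

variable {X : Type*} [NormedAddCommGroup X] {f : X → ℝ} {A L : ℝ}

/-- The infimal convolution of `f` with `L ‖·‖`. -/
noncomputable def infConv (L : ℝ) (f : X → ℝ) (x : X) : ℝ := ⨅ z, (f (x + z) + L * ‖z‖)

variable (hf : ∀ x y, f x ≤ f y + (A + L * ‖x - y‖))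
include hf

theorem sub_le_add_mul_norm (x z : X) : f x - A ≤ f (x + z) + L * ‖z‖ := by
  have := hf x (x + z)
  rw [sub_add_cancel_left, norm_neg] at this
  linarith

theorem infConv_le_add (x z : X) : infConv L f x ≤ f (x + z) + L * ‖z‖ :=
  ciInf_le ⟨f x - A, by rintro _ ⟨z, rfl⟩; exact sub_le_add_mul_norm hf x z⟩ z

theorem infConv_le (x : X) : infConv L f x ≤ f x := by
  simpa using infConv_le_add hf x 0

theorem sub_le_infConv (x : X) : f x - A ≤ infConv L f x :=
  le_ciInf fun z => sub_le_add_mul_norm hf x z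

/-- Because the infimum runs over displacements, a translation-invariant increment bound for `f`
passes to its infimal convolution with the same constant. -/
theorem infConv_le_infConv_add {x y : X} {c : ℝ} (h : ∀ z, f (x + z) ≤ f (y + z) + c) :
    infConv L f x ≤ infConv L f y + c := by
  rw [← sub_le_iff_le_add]
  refine le_ciInf fun z => ?_
  linarith [infConv_le_add hf x z, h z]

theorem lipBound_infConv (hL : 0 ≤ L) : LipBound L (infConv L f) := by
  refine lipBound_of_le_add fun x y => ?_
  rw [← sub_le_iff_le_add]
  refine le_ciInf fun z => ?_
  have h1 := infConv_le_add hf x (y - x + z)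
  rw [← add_assoc, add_sub_cancel] at h1
  have h2 : L * ‖y - x + z‖ ≤ L * (‖x - y‖ + ‖z‖) := by
    gcongr
    rw [norm_sub_rev x y]
    exact norm_add_le _ _
  linarith

theorem infConv_mem_bddSupp (hA : 0 ≤ A) (hL : 0 < L) (hs : f ∈ BddSupp X ℝ) :
    infConv L f ∈ BddSupp X ℝ := by
  obtain ⟨B, hB0, hB⟩ := exists_bound_of_mem_bddSupp hA hL.le hf hs
  obtain ⟨R, hR0, hR⟩ := hs
  refine ⟨R + B / L, by positivity, fun x hx => le_antisymm ?_ ?_⟩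
  · have h0 : f x = 0 := hR x (by have := div_nonneg hB0 hL.le; linarith)
    exact h0 ▸ infConv_le hf x
  · refine le_ciInf fun z => ?_
    rcases lt_or_ge R ‖x + z‖ with h | h
    · rw [hR _ h]; positivity
    · have h1 : ‖x‖ ≤ ‖x + z‖ + ‖z‖ := by simpa using norm_sub_le (x + z) z
      have h2 : B / L ≤ ‖z‖ := by linarith
      rw [div_le_iff₀ hL] at h2
      linarith [neg_le_of_abs_le (hB (x + z))]

end InfConvolution

/-! ### From small-scale vanishing to Lipschitz to `C^k` -/

section Approximation

variable {X : Type*} [NormedAddCommGroup X] [NormedSpace ℝ X] {ω : ℝ → ℝ} {f : X → ℝ} {k : ℕ∞}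

theorem abs_sub_le_nat_mul {A δ : ℝ} (hf : ∀ x y, ‖x - y‖ < δ → |f x - f y| ≤ A) (n : ℕ)
    (x y : X) (h : ‖x - y‖ < n * δ) : |f x - f y| ≤ n * A := by
  induction n generalizing x y with
  | zero => simp at h; linarith [norm_nonneg (x - y)]
  | succ n ih =>
    rcases Nat.eq_zero_or_pos n with rfl | hn
    · simpa using hf x y (by simpa using h)
    have hn' : (0 : ℝ) < n := by exact_mod_cast hn
    push_cast at h ⊢
    -- Cut the segment at its last `(n + 1)`-th part: a single short step from `w` to `x`, and `n`
    -- of them from `y` to `w`.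
    set w : X := y + ((n : ℝ) / (n + 1)) • (x - y) with hw
    have h1 : ‖x - w‖ < δ := by
      have : x - w = (1 / ((n : ℝ) + 1)) • (x - y) := by
        rw [hw, show x - (y + ((n : ℝ) / (n + 1)) • (x - y))
          = (1 : ℝ) • (x - y) - ((n : ℝ) / (n + 1)) • (x - y) by rw [one_smul]; abel, ← sub_smul]
        congr 1
        field_simp
        ring
      rw [this, norm_smul, Real.norm_of_nonneg (by positivity), one_div,
        inv_mul_lt_iff₀ (by positivity)]
      exact h
    have h2 : ‖w - y‖ < n * δ := by
      rw [hw, add_sub_cancel_left, norm_smul, Real.norm_of_nonneg (by positivity),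
        div_mul_eq_mul_div, div_lt_iff₀ (by positivity), mul_assoc, mul_comm δ]
      gcongr
    have h3 := abs_sub_le (f x) (f w) (f y)
    linarith [hf x w h1, ih w y h2]

/-- Below scale `δ` both `f` and its infimal convolution have increments at most `ε / 2 * ω`. Above
it, the two differ pointwise by at most `A = ε / 2 * ω δ`, which monotonicity of `ω` absorbs. -/
theorem exists_lipBound_approx (hω : IsModulus ω) (hf : f ∈ VSmall X ℝ ω) {ε : ℝ} (hε : 0 < ε) :
    ∃ (h : X → ℝ) (L : ℝ), 0 < L ∧ LipBound L h ∧ (HolderBound ω ε fun x => h x - f x) ∧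
      (f ∈ BddSupp X ℝ → h ∈ BddSupp X ℝ) := by
  obtain ⟨δ, hδ, H⟩ := (mem_vSmall_iff hω).1 hf (ε / 2) (half_pos hε)
  set A := ε / 2 * ω δ with hA
  have hωδ := hω.pos hδ
  have hApos : 0 < A := by positivity
  have hloc : ∀ x y, ‖x - y‖ < δ → |f x - f y| ≤ A := by
    intro x y h
    rcases eq_or_ne x y with rfl | hxy
    · simpa using hApos.le
    · refine (H x y hxy h).trans ?_
      rw [hA]
      gcongr
      exact hω.mono (norm_sub_pos_iff.2 hxy) h.le
  have hcoarse : ∀ x y, f x ≤ f y + (A + A / δ * ‖x - y‖) := by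
    intro x y
    have h1 : ‖x - y‖ < ((⌊‖x - y‖ / δ⌋₊ + 1 : ℕ) : ℝ) * δ := by
      rw [← div_lt_iff₀ hδ]; push_cast; exact Nat.lt_floor_add_one _
    have h2 := (abs_le.1 (abs_sub_le_nat_mul hloc _ x y h1)).2
    have h3 : (⌊‖x - y‖ / δ⌋₊ : ℝ) ≤ ‖x - y‖ / δ := Nat.floor_le (by positivity)
    push_cast at h2
    have h4 : (⌊‖x - y‖ / δ⌋₊ : ℝ) * A ≤ ‖x - y‖ / δ * A := by gcongr
    have h5 : ‖x - y‖ / δ * A = A / δ * ‖x - y‖ := by ring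
    linarith
  refine ⟨infConv (A / δ) f, A / δ, by positivity, lipBound_infConv hcoarse (by positivity), ?_,
    infConv_mem_bddSupp hcoarse hApos.le (by positivity)⟩
  intro x y hxy
  have hp := hω.norm_sub_pos hxy
  rcases lt_or_ge ‖x - y‖ δ with h | h
  · have hshift : ∀ z, |f (x + z) - f (y + z)| ≤ ε / 2 * ω ‖x - y‖ := fun z => by
      have := H (x + z) (y + z) (by simpa using hxy) (by simpa using h)
      rwa [add_sub_add_right_eq_sub] at this
    have h1 := infConv_le_infConv_add hcoarse (x := x) (y := y) (c := ε / 2 * ω ‖x - y‖)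
      fun z => by linarith [(abs_le.1 (hshift z)).2]
    have h2 := infConv_le_infConv_add hcoarse (x := y) (y := x) (c := ε / 2 * ω ‖x - y‖)
      fun z => by linarith [(abs_le.1 (hshift z)).1]
    have h3 := abs_le.1 (H x y hxy h)
    rw [abs_le]
    constructor <;> linarith
  · have h0 : A ≤ ε / 2 * ω ‖x - y‖ := by
      rw [hA]
      gcongr
      exact hω.mono hδ h
    have h1 := infConv_le hcoarse x
    have h2 := infConv_le hcoarse y
    have h3 := sub_le_infConv hcoarse x
    have h4 := sub_le_infConv hcoarse y
    rw [abs_le]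
    constructor <;> linarith

/-- A smooth approximation of the identity of `ℝ` vanishing on `[-1, 1]`. -/
noncomputable def deadZone (t : ℝ) : ℝ := smoothRamp (t - 1) - smoothRamp (-t - 1)

theorem deadZone_of_abs_le {t : ℝ} (ht : |t| ≤ 1) : deadZone t = 0 := by
  rw [abs_le] at ht
  rw [deadZone, smoothRamp_of_nonpos (by linarith), smoothRamp_of_nonpos (by linarith), sub_zero]

theorem abs_deadZone_sub_self_le (t : ℝ) : |deadZone t - t| ≤ 2 := by
  have h1 := sub_one_le_smoothRamp (t - 1)
  have h2 := sub_one_le_smoothRamp (-t - 1)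
  have hle : ∀ s : ℝ, 0 ≤ s → smoothRamp (s - 1) ≤ s := fun s hs => by
    simpa using (monotone_smoothRamp (show s - 1 ≤ s by linarith)).trans (smoothRamp_le hs)
  unfold deadZone
  rcases le_total 0 t with h | h
  · have := hle t h
    rw [smoothRamp_of_nonpos (show -t - 1 ≤ 0 by linarith), abs_le]
    constructor <;> linarith
  · have := hle (-t) (by linarith)
    rw [smoothRamp_of_nonpos (show t - 1 ≤ 0 by linarith), abs_le]
    constructor <;> linarith

theorem abs_deadZone_sub_le (s t : ℝ) : |deadZone s - deadZone t| ≤ 2 * |s - t| := by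
  have h1 := abs_smoothRamp_sub_le (s - 1) (t - 1)
  have h2 := abs_smoothRamp_sub_le (-s - 1) (-t - 1)
  rw [sub_sub_sub_cancel_right] at h1 h2
  rw [neg_sub_neg, abs_sub_comm t s] at h2
  unfold deadZone
  rw [show smoothRamp (s - 1) - smoothRamp (-s - 1) - (smoothRamp (t - 1) - smoothRamp (-t - 1))
    = (smoothRamp (s - 1) - smoothRamp (t - 1)) - (smoothRamp (-s - 1) - smoothRamp (-t - 1))
    by ring]
  linarith [abs_sub (smoothRamp (s - 1) - smoothRamp (t - 1))
    (smoothRamp (-s - 1) - smoothRamp (-t - 1))]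

/-- Uniform approximation alone may destroy bounded support. Composing with a dead zone of width `η`
restores it, since `|g| ≤ η` wherever `h` vanishes; the cost is a factor 2 in the Lipschitz constant
and an error `2 * η`. -/
theorem HasCkLipBump.exists_contDiff_holder_approx [TopologicalSpace.SeparableSpace X]
    (hb : HasCkLipBump X k) (hω : IsModulus ω) {L : ℝ} (hL : 0 < L) {h : X → ℝ}
    (hh : LipBound L h) {ε : ℝ} (hε : 0 < ε) :
    ∃ g : X → ℝ, ContDiff ℝ k g ∧ g ∈ LipFun X ℝ ∧ (HolderBound ω ε fun x => g x - h x) ∧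
      (h ∈ BddSupp X ℝ → g ∈ BddSupp X ℝ) := by
  obtain ⟨M, hM, H⟩ := hb.exists_approx_of_lipBound hL hh
  obtain ⟨r, hr, hrω⟩ := hω.exists_le_mul (show 0 ≤ 2 * M + L by positivity) hε
  have hωr := hω.pos hr
  -- The scale `r` depends on `M`, so `η` can be chosen after it only because `M` does not depend on
  -- `η`. Two points with error `3 * η` each give the 6.
  set η := ε * ω r / 6 with hη
  have hηpos : 0 < η := by positivity
  obtain ⟨g, hgC, hgL, hgh⟩ := H η hηpos
  have hlip : LipBound (2 * M) fun x => η * deadZone (η⁻¹ * g x) := fun x y => by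
    rw [← mul_sub, abs_mul, abs_of_pos hηpos]
    calc _ ≤ η * (2 * |η⁻¹ * g x - η⁻¹ * g y|) := by gcongr; exact abs_deadZone_sub_le _ _
      _ = 2 * |g x - g y| := by
        rw [← mul_sub, abs_mul, abs_of_pos (inv_pos.2 hηpos)]; field_simp
      _ ≤ 2 * (M * ‖x - y‖) := by gcongr; exact hgL x y
      _ = 2 * M * ‖x - y‖ := by ring
  have hclose : ∀ x, |η * deadZone (η⁻¹ * g x) - h x| ≤ 3 * η := fun x => by
    have h1 : |η * deadZone (η⁻¹ * g x) - g x| ≤ η * 2 := by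
      rw [show η * deadZone (η⁻¹ * g x) - g x = η * (deadZone (η⁻¹ * g x) - η⁻¹ * g x) by
        field_simp, abs_mul, abs_of_pos hηpos]
      gcongr
      exact abs_deadZone_sub_self_le _
    have h2 := hgh x
    have h3 := abs_sub_le (η * deadZone (η⁻¹ * g x)) (g x) (h x)
    linarith
  refine ⟨fun x => η * deadZone (η⁻¹ * g x), ?_, hlip.mem_lipFun, ?_, ?_⟩
  · refine contDiff_const.mul (ContDiff.sub ?_ ?_)
    · exact contDiff_smoothRamp.comp (by fun_prop)
    · exact contDiff_smoothRamp.comp (by fun_prop)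
  · intro x y hxy
    rcases lt_or_ge ‖x - y‖ r with hlt | hge
    · have h1 := hrω _ (norm_sub_pos_iff.2 hxy) hlt
      have h2 := abs_le.1 (hlip x y)
      have h3 := abs_le.1 (hh x y)
      rw [abs_le]
      constructor <;> linarith
    · have h1 : ε * ω r ≤ ε * ω ‖x - y‖ := by gcongr; exact hω.mono hr hge
      have h2 := abs_le.1 (hclose x)
      have h3 := abs_le.1 (hclose y)
      rw [abs_le]
      constructor <;> linarith
  · rintro ⟨R, hR0, hR⟩
    refine ⟨R, hR0, fun x hx => ?_⟩
    have h1 := hgh x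
    rw [hR x hx, sub_zero] at h1
    have : |η⁻¹ * g x| ≤ 1 := by
      rwa [abs_mul, abs_of_pos (inv_pos.2 hηpos), inv_mul_le_iff₀ hηpos, mul_one]
    simp [deadZone_of_abs_le this]

theorem HasCkLipBump.exists_approx_of_mem_vSmall [TopologicalSpace.SeparableSpace X]
    (hb : HasCkLipBump X k) (hω : IsModulus ω) (hf : f ∈ VSmall X ℝ ω) {ε : ℝ} (hε : 0 < ε) :
    ∃ g : X → ℝ, ContDiff ℝ k g ∧ g ∈ LipFun X ℝ ∧ (HolderBound ω ε fun x => g x - f x) ∧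
      (f ∈ BddSupp X ℝ → g ∈ BddSupp X ℝ) := by
  obtain ⟨h, L, hL, hh, hhf, hhs⟩ := exists_lipBound_approx hω hf (half_pos hε)
  obtain ⟨g, hgC, hgL, hgh, hgs⟩ := hb.exists_contDiff_holder_approx hω hL hh (half_pos hε)
  refine ⟨g, hgC, hgL, ?_, fun hs => hgs (hhs hs)⟩
  simpa using hgh.add hhf

end Approximation

/-! ### Reduction to bounded support -/

section Truncation

variable {X : Type*} [NormedAddCommGroup X] {ω : ℝ → ℝ} {f : X → ℝ}

/-- Clamping gives the maximum of the two increments, where multiplication by a cutoff would involve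
the size of `f`. -/
theorem abs_clamp_sub_le {a b a' b' c : ℝ} (ha : |a - a'| ≤ c) (hb : |b - b'| ≤ c) :
    |max (-b) (min a b) - max (-b') (min a' b')| ≤ c := by
  refine (abs_max_sub_max_le_max _ _ _ _).trans (max_le ?_ ?_)
  · rwa [neg_sub_neg, abs_sub_comm]
  · exact (abs_min_sub_min_le_max _ _ _ _).trans (max_le ha hb)

theorem exists_cutoff (hω : IsModulus ω) {ε N r : ℝ} (hε : 0 < ε) (hN : 0 ≤ N) (hr : 0 < r) :
    ∃ (φ : X → ℝ) (a : ℝ), 0 ≤ a ∧ LipBound a φ ∧ φ ∈ BddSupp X ℝ ∧ HolderBound ω ε φ ∧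
      ∀ x, ‖x‖ ≤ r → φ x = N := by
  obtain ⟨δ, hδ, hδω⟩ := hω.exists_le_mul zero_le_one hε
  obtain ⟨D, hD⟩ := eventually_atTop.1 (hω.tendsto_atTop.eventually_ge_atTop (N / ε))
  have hωδ := hω.pos hδ
  -- Slope at most 1 settles distances below `δ`, the second bound those between `δ` and `D`; beyond
  -- `D` the height satisfies `N ≤ ε * ω`.
  set a := min 1 (ε * ω δ / (|D| + δ)) with ha
  have hapos : 0 < a := by positivity
  have hlip : LipBound a fun x : X => max 0 (N - a * max 0 (‖x‖ - r)) := fun x y => by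
    refine (abs_max_sub_max_le_max _ _ _ _).trans (max_le ?_ ?_)
    · simp; positivity
    · rw [sub_sub_sub_cancel_left, ← mul_sub, abs_mul, abs_of_pos hapos]
      gcongr
      refine (abs_max_sub_max_le_max _ _ _ _).trans (max_le (by simp) ?_)
      rw [sub_sub_sub_cancel_right, norm_sub_rev]
      exact abs_norm_sub_norm_le y x
  refine ⟨fun x => max 0 (N - a * max 0 (‖x‖ - r)), a, hapos.le, hlip, ?_, ?_, ?_⟩
  · refine ⟨r + N / a, by positivity, fun x hx => max_eq_left ?_⟩
    have h1 : N / a ≤ max 0 (‖x‖ - r) := le_max_of_le_right (by linarith)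
    rw [div_le_iff₀ hapos] at h1
    linarith
  · intro x y hxy
    have ht := norm_sub_pos_iff.2 hxy
    rcases lt_or_ge ‖x - y‖ D with hlt | hge
    · refine (hlip x y).trans ?_
      rcases lt_or_ge ‖x - y‖ δ with h | h
      · refine le_trans ?_ (hδω _ ht h)
        gcongr
        exact min_le_left _ _
      · calc a * ‖x - y‖ ≤ ε * ω δ / (|D| + δ) * (|D| + δ) := by
              gcongr
              · exact min_le_right _ _
              · linarith [le_abs_self D]
          _ = ε * ω δ := by field_simp
          _ ≤ ε * ω ‖x - y‖ := by gcongr; exact hω.mono hδ h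
    · have h1 := hD _ hge
      rw [div_le_iff₀ hε] at h1
      have hb : ∀ z : X, 0 ≤ max 0 (N - a * max 0 (‖z‖ - r)) ∧
          max 0 (N - a * max 0 (‖z‖ - r)) ≤ N := fun z =>
        ⟨le_max_left _ _, max_le hN (sub_le_self _ (by positivity))⟩
      have h2 := hb x
      have h3 := hb y
      rw [abs_le]
      constructor <;> linarith
  · intro x hx
    simp only
    rw [max_eq_left (show ‖x‖ - r ≤ 0 by linarith), mul_zero, sub_zero, max_eq_right hN]

theorem exists_bddSupp_approx (hω : IsModulus ω) (hf : f ∈ VC X ℝ ω) {ε : ℝ} (hε : 0 < ε) :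
    ∃ g : X → ℝ, g ∈ VSmall X ℝ ω ∧ g ∈ BddSupp X ℝ ∧ HolderBound ω ε fun x => g x - f x := by
  obtain ⟨⟨⟨hS, hH⟩, hF, -⟩, hL, -⟩ := hf
  obtain ⟨c, hc, hH⟩ := (mem_holderSpace_iff hω).1 hH
  obtain ⟨D₁, hD₁⟩ := (mem_vLarge_iff hω).1 hL (ε / 2) (half_pos hε)
  obtain ⟨D₂, hD₂⟩ := (mem_vFar_iff hω).1 hF (ε / 2) (half_pos hε)
  set D := max 1 (max D₁ D₂) with hD
  have hDpos : 0 < D := one_pos.trans_le (le_max_left _ _)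
  have hDD₁ : D₁ ≤ D := (le_max_left _ _).trans (le_max_right _ _)
  have hDD₂ : D₂ ≤ D := (le_max_right _ _).trans (le_max_right _ _)
  have hω2 := hω.pos (show 0 < 2 * D by positivity)
  set N := |f 0| + c * ω (2 * D) with hN
  have hN0 : 0 ≤ N := by positivity
  have hfN : ∀ x, ‖x‖ ≤ 2 * D → |f x| ≤ N := by
    intro x hx
    rcases eq_or_ne x 0 with rfl | h0
    · rw [hN]; linarith [mul_nonneg hc hω2.le]
    · have h1 := hH x 0 h0
      rw [sub_zero] at h1
      have h2 : c * ω ‖x‖ ≤ c * ω (2 * D) := by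
        gcongr
        exact hω.mono (norm_pos_iff.2 h0) hx
      linarith [abs_sub_abs_le_abs_sub (f x) (f 0)]
  obtain ⟨φ, a, ha, hφL, hφS, hφH, hφN⟩ :=
    exists_cutoff (X := X) hω (half_pos hε) hN0 (show 0 < 2 * D by positivity)
  refine ⟨fun x => max (-φ x) (min (f x) (φ x)), ?_, ?_, ?_⟩
  · refine (mem_vSmall_iff hω).2 fun e he => ?_
    obtain ⟨δ₁, hδ₁, h₁⟩ := (mem_vSmall_iff hω).1 hS e he
    obtain ⟨δ₂, hδ₂, h₂⟩ := (mem_vSmall_iff hω).1 (hφL.mem_vSmall hω ha) e he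
    exact ⟨min δ₁ δ₂, lt_min hδ₁ hδ₂, fun x y hxy hlt => abs_clamp_sub_le
      (h₁ x y hxy (hlt.trans_le (min_le_left _ _))) (h₂ x y hxy (hlt.trans_le (min_le_right _ _)))⟩
  · obtain ⟨R, hR0, hR⟩ := hφS
    refine ⟨R, hR0, fun x hx => ?_⟩
    simp [hR x hx]
  · intro x y hxy
    have key : |f x - f y| ≤ ε / 2 * ω ‖x - y‖ →
        |max (-φ x) (min (f x) (φ x)) - f x - (max (-φ y) (min (f y) (φ y)) - f y)|
          ≤ ε * ω ‖x - y‖ := fun h => by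
      have h1 := abs_clamp_sub_le h (hφH x y hxy)
      rw [sub_sub_sub_comm]
      exact (abs_sub _ _).trans ((add_le_add h1 h).trans_eq (by ring))
    -- Distant pairs use large-scale vanishing, pairs outside the ball of radius `D` use far
    -- vanishing. Any other pair lies in the ball of radius `2 * D`, where the clamp does nothing.
    rcases le_or_gt D ‖x - y‖ with h | h
    · exact key (hD₁ x y hxy (hDD₁.trans h))
    by_cases hfar : D < ‖x‖ ∧ D < ‖y‖
    · exact key (hD₂ x y hxy (hDD₂.trans_lt hfar.1) (hDD₂.trans_lt hfar.2))
    have hx2 : ‖x‖ ≤ 2 * D ∧ ‖y‖ ≤ 2 * D := by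
      have h1 := (abs_le.1 (abs_norm_sub_norm_le x y)).1
      have h2 := (abs_le.1 (abs_norm_sub_norm_le x y)).2
      rw [not_and_or, not_lt, not_lt] at hfar
      rcases hfar with h3 | h3 <;> constructor <;> linarith
    have hfix : ∀ z, ‖z‖ ≤ 2 * D → max (-φ z) (min (f z) (φ z)) = f z := fun z hz => by
      have h1 := abs_le.1 (hfN z hz)
      rw [hφN z hz, min_eq_left h1.2, max_eq_right h1.1]
    beta_reduce
    rw [hfix x hx2.1, hfix y hx2.2]
    have := hω.norm_sub_pos hxy
    simp
    positivity

end Truncation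

end VanishingHolder

theorem mainTheorem2 {X : Type*} [NormedAddCommGroup X] [NormedSpace ℝ X]
    [TopologicalSpace.SeparableSpace X] (k : ℕ∞)
    (hbump : VanishingHolder.HasCkLipBump X k)
    (ω : ℝ → ℝ) (hω : VanishingHolder.IsModulus ω) :
    VanishingHolder.holderClosure ω
        (VanishingHolder.CkFun X ℝ k ∩ VanishingHolder.LipFun X ℝ ∩
          VanishingHolder.HolderSpace X ℝ ω) = VanishingHolder.VCSmall X ℝ ω ∧
      VanishingHolder.holderClosure ω
        (VanishingHolder.CkFun X ℝ k ∩ VanishingHolder.BddSupp X ℝ ∩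
          VanishingHolder.LipFun X ℝ) = VanishingHolder.VC X ℝ ω := by
  open VanishingHolder in
  constructor
  · refine (holderClosure_subset_vcSmall hω fun f hf => hf.1.2).antisymm fun f hf => ?_
    refine (mem_holderClosure_iff hω).2 ⟨hf.2, fun ε hε => ?_⟩
    obtain ⟨g, hgC, hgL, hgf, -⟩ := hbump.exists_approx_of_mem_vSmall hω hf.1 hε
    obtain ⟨c, hc, hcf⟩ := (mem_holderSpace_iff hω).1 hf.2
    refine ⟨g, ⟨⟨hgC, hgL⟩, (mem_holderSpace_iff hω).2 ⟨ε + c, by positivity, ?_⟩⟩, hgf⟩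
    simpa using hgf.add hcf
  · refine (holderClosure_subset_vc hω (fun f hf => hf.2) fun f hf => hf.1.2).antisymm
      fun f hf => ?_
    refine (mem_holderClosure_iff hω).2 ⟨hf.1.1.2, fun ε hε => ?_⟩
    obtain ⟨h, hhS, hhB, hhf⟩ := exists_bddSupp_approx hω hf (half_pos hε)
    obtain ⟨g, hgC, hgL, hgh, hgB⟩ := hbump.exists_approx_of_mem_vSmall hω hhS (half_pos hε)
    refine ⟨g, ⟨⟨hgC, hgB hhB⟩, hgL⟩, ?_⟩
    simpa using hgh.add hhf
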